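/- Let $\Lambda$ be a finite set of $N$ sites, let $t_{jk}\in\mathbb{C}$ ($j,k\in\Lambda$) with $t_{jj}=0$, and let $\mu_j,V_{jk}\in\mathbb{R}$. Consider the Hamiltonian $$\mathcal H=-\sum_{j,k}\left(t_{jk}c_j^\dagger c_k+\overline{t_{jk}}\,c_k^\dagger c_j\right)-\sum_j\mu_j n_j+\sum_{j,k}V_{jk}n_jn_k,\qquad n_j=c_j^\dagger c_j .$$ For spinless fermions, $c_j=f_j$ are the annihilation operators on the fermionic Fock space over $\Lambda$, satisfying the canonical anticommutation relations. For hard-core bosons, $c_j=b_j$ are the annihilation operators on the bosonic Fock space over $\Lambda$, satisfying the canonical commutation relations, and $\mathcal H$ is compressed to the subspace of states obeying the hard-core constraint $n_j\in\{0,1\}$ for all $j$. Let $E_0^{\rm B}(M)$ and $E_0^{\rm F}(M)$ be the ground-state energies (smallest eigenvalues) of hard-core bosons and of fermions in the sector with $\sum_j n_j=M$, and let $E_0^{\rm B}$ and $E_0^{\rm F}$ be their ground-state energies over all particle numbers (grand-canonical setting, with the chemical potential included in the $\mu_j$). Suppose that all hopping amplitudes $t_{jk}$ are real and non-negative. Then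 $E_0^{\rm B}(M)\le E_0^{\rm F}(M)$ for every $M$ with $0\le M\le N$, and $E_0^{\rm B}\le E_0^{\rm F}$. Call two distinct sites $j,k$ connected if $t_{jk}\neq0$ or $t_{kj}\ne0$. If, in addition, the resulting graph on $\Lambda$ is connected and has a site connected to at least three other sites, and $2\le M\le N-2$, then $E_0^{\rm B}(M)<E_0^{\rm F}(M)$. -/

import Mathlib

noncomputable section

namespace LatticeParticles

variable {Λ : Type*}

/-- The Hamiltonian
`-∑_{j,k} (t_{jk} c†_j c_k + h.c.) - ∑_j μ_j n_j + ∑_{j,k} V_{jk} n_j n_k`, `n_j = c†_j c_j`,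
for given annihilation operators `c` and creation operators `cd` acting on a space `W`. -/
def hamiltonian [Fintype Λ] {W : Type*} [AddCommGroup W] [Module ℂ W]
    (c cd : Λ → Module.End ℂ W) (t : Λ → Λ → ℂ) (μ : Λ → ℝ) (V : Λ → Λ → ℝ) :
    Module.End ℂ W :=
  -(∑ j, ∑ k, (t j k • (cd j * c k) + (starRingEnd ℂ) (t j k) • (cd k * c j)))
    - ∑ j, (μ j : ℂ) • (cd j * c j)
    + ∑ j, ∑ k, (V j k : ℂ) • ((cd j * c j) * (cd k * c k))

/-- `E` is the ground-state energy of `H` on the subspace `S`: the smallest (real) eigenvalue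
of `H` belonging to an eigenvector in `S`. -/
def IsGroundStateEnergy {W : Type*} [AddCommGroup W] [Module ℂ W]
    (H : Module.End ℂ W) (S : Submodule ℂ W) (E : ℝ) : Prop :=
  IsLeast {x : ℝ | ∃ ψ ∈ S, ψ ≠ 0 ∧ H ψ = (x : ℂ) • ψ} E

/-! ### Spinless fermions -/

/-- Fermionic Fock space: the orthonormal occupation number basis is labelled by the set of
occupied sites. -/
abbrev FermiFock (Λ : Type*) := Finset Λ →₀ ℂ

/-- The sign `(-1)^(number of occupied sites before j)`, for a fixed ordering of the sites. -/
def fermiSign [LinearOrder Λ] (j : Λ) (s : Finset Λ) : ℂ :=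
  (-1) ^ (s.filter (fun i => i < j)).card

/-- Fermion annihilation operator `f_j`. -/
def fermiAnn [LinearOrder Λ] (j : Λ) : Module.End ℂ (FermiFock Λ) :=
  Finsupp.linearCombination ℂ fun s : Finset Λ =>
    if j ∈ s then Finsupp.single (s.erase j) (fermiSign j s) else 0

/-- Fermion creation operator `f†_j`. -/
def fermiCre [LinearOrder Λ] (j : Λ) : Module.End ℂ (FermiFock Λ) :=
  Finsupp.linearCombination ℂ fun s : Finset Λ =>
    if j ∈ s then 0 else Finsupp.single (insert j s) (fermiSign j s)

/-- The Hamiltonian of spinless fermions. -/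
def fermiHam [Fintype Λ] [LinearOrder Λ] (t : Λ → Λ → ℂ) (μ : Λ → ℝ) (V : Λ → Λ → ℝ) :
    Module.End ℂ (FermiFock Λ) :=
  hamiltonian fermiAnn fermiCre t μ V

/-- The space of fermionic states with `M` particles. -/
def fermiSector (Λ : Type*) (M : ℕ) : Submodule ℂ (FermiFock Λ) :=
  Finsupp.supported ℂ ℂ {s : Finset Λ | s.card = M}

/-! ### Hard-core bosons -/

/-- Bosonic Fock space (its dense subspace of finite combinations of basis states): the
orthonormal occupation number basis is labelled by the occupation numbers `n_j = 0, 1, 2, …`. -/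
abbrev BoseFock (Λ : Type*) := (Λ → ℕ) →₀ ℂ

/-- Boson annihilation operator: `b_j |n⟩ = √(n_j) |n - δ_j⟩`. -/
def boseAnn [DecidableEq Λ] (j : Λ) : Module.End ℂ (BoseFock Λ) :=
  Finsupp.linearCombination ℂ fun n : Λ → ℕ =>
    Finsupp.single (n - Pi.single j 1) ((Real.sqrt (n j) : ℝ) : ℂ)

/-- Boson creation operator: `b†_j |n⟩ = √(n_j + 1) |n + δ_j⟩`. -/
def boseCre [DecidableEq Λ] (j : Λ) : Module.End ℂ (BoseFock Λ) :=
  Finsupp.linearCombination ℂ fun n : Λ → ℕ =>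
    Finsupp.single (n + Pi.single j 1) ((Real.sqrt (n j + 1) : ℝ) : ℂ)

/-- The configurations obeying the hard-core constraint `n_j ∈ {0, 1}` at every site. -/
def hardCoreConfigs (Λ : Type*) : Set (Λ → ℕ) := {n | ∀ j, n j ≤ 1}

open Classical in
/-- The orthogonal projection onto the states obeying the hard-core constraint. -/
def hardCoreProj (Λ : Type*) : Module.End ℂ (BoseFock Λ) :=
  Finsupp.linearCombination ℂ fun n : Λ → ℕ =>
    if n ∈ hardCoreConfigs Λ then Finsupp.single n 1 else 0

/-- The Hamiltonian of hard-core bosons: the bosonic Hamiltonian compressed to the states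
obeying the hard-core constraint. -/
def hardCoreHam [Fintype Λ] [DecidableEq Λ] (t : Λ → Λ → ℂ) (μ : Λ → ℝ) (V : Λ → Λ → ℝ) :
    Module.End ℂ (BoseFock Λ) :=
  hardCoreProj Λ * hamiltonian boseAnn boseCre t μ V * hardCoreProj Λ

/-- The space of all hard-core boson states. -/
def hardCoreSpace (Λ : Type*) : Submodule ℂ (BoseFock Λ) :=
  Finsupp.supported ℂ ℂ (hardCoreConfigs Λ)

/-- The space of hard-core boson states with `M` particles. -/
def hardCoreSector (Λ : Type*) [Fintype Λ] (M : ℕ) : Submodule ℂ (BoseFock Λ) :=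
  Finsupp.supported ℂ ℂ {n : Λ → ℕ | n ∈ hardCoreConfigs Λ ∧ ∑ j, n j = M}

/-! ### The lattice -/

/-- Two different sites are connected if there is a nonzero hopping amplitude between them. -/
def hoppingGraph (t : Λ → Λ → ℂ) : SimpleGraph Λ :=
  SimpleGraph.fromRel fun j k => t j k ≠ 0

end LatticeParticles

end

/-! In the basis of occupied sets, hard-core bosons and fermions are described by real symmetric
matrices B and F with the same diagonal. For a hop from k to j the entry is -(t_jk + t_kj) in B and
the same up to a sign in F, so `Dominates B F` holds.

For a fermionic ground state f, the trial state |f| gives ⟨|f|, B|f|⟩ ≤ ⟨f, F f⟩, hence EB ≤ EF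
(`Dominates.groundEnergy_le`). This works in each sector and on the whole space.

If EB = EF in a sector, the comparison is an equality term by term and |f| is a bosonic ground
state. On a connected graph a Perron-Frobenius argument (`Dominates.zero_of_groundEnergy_eq`,
`forall_configs_of_connected`) shows that f vanishes nowhere. Every fermionic hop sign then agrees
with the sign of the product of the two amplitudes of f. Two particles moving around a site with
three neighbours can be exchanged, which produces a factor -1 and a contradiction
(`no_positive_fermi_amplitude`). -/

namespace LatticeParticles

open Matrix

/-! ### Comparison of ground states of real symmetric matrices -/

section Matrices

variable {ι : Type*}

/-- `B` has the same diagonal as `F`, and its off-diagonal entries are nonpositive and at least as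
large in absolute value as those of `F`. -/
structure Dominates (B F : Matrix ι ι ℝ) : Prop where
  diag : ∀ i, B i i = F i i
  off_diag : ∀ i j, i ≠ j → |F i j| ≤ -B i j

theorem Dominates.entry_le {B F : Matrix ι ι ℝ} (h : Dominates B F) (u : ι → ℝ) (i j : ι) :
    |u i| * (B i j * |u j|) ≤ u i * (F i j * u j) := by
  by_cases hij : i = j
  · subst hij
    have := abs_mul_abs_self (u i)
    rw [h.diag]
    exact le_of_eq (by linear_combination F i i * this)
  · have h1 := h.off_diag i j hij
    have h2 := neg_abs_le (u i * (F i j * u j))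
    rw [abs_mul, abs_mul] at h2
    have h3 := mul_le_mul_of_nonneg_left h1 (mul_nonneg (abs_nonneg (u i)) (abs_nonneg (u j)))
    nlinarith

variable [Fintype ι]

/-- `E` is the smallest eigenvalue of the real symmetric matrix `A`, with eigenvector `v`. -/
structure IsGroundPair (A : Matrix ι ι ℝ) (E : ℝ) (v : ι → ℝ) : Prop where
  ne_zero : v ≠ 0
  eigen : A *ᵥ v = E • v
  le_form : ∀ u : ι → ℝ, E * (u ⬝ᵥ u) ≤ u ⬝ᵥ A *ᵥ u

theorem exists_isGroundPair [Nonempty ι] {A : Matrix ι ι ℝ} (hA : A.IsSymm) :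
    ∃ E v, IsGroundPair A E v := by
  classical
  have hH : A.IsHermitian := by
    rw [Matrix.IsHermitian, Matrix.conjTranspose_eq_transpose_of_trivial]; exact hA
  obtain ⟨i, hi⟩ := Finite.exists_min hH.eigenvalues
  refine ⟨hH.eigenvalues i, ⇑(hH.eigenvectorBasis i), ?_, hH.mulVec_eigenvectorBasis i, ?_⟩
  · intro h
    have h1 := hH.eigenvectorBasis.orthonormal.ne_zero i
    apply h1
    ext j
    exact congrFun h j
  · intro u
    have hB : (A - hH.eigenvalues i • (1 : Matrix ι ι ℝ)).PosSemidef := by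
      have hd : (diagonal (fun j => hH.eigenvalues j - hH.eigenvalues i)).PosSemidef :=
        Matrix.PosSemidef.diagonal fun j => by simpa using hi j
      have h2 := hd.mul_mul_conjTranspose_same (hH.eigenvectorUnitary : Matrix ι ι ℝ)
      have h3 : (hH.eigenvectorUnitary : Matrix ι ι ℝ) *
          (hH.eigenvectorUnitary : Matrix ι ι ℝ)ᴴ = 1 :=
        (Unitary.mem_iff.1 hH.eigenvectorUnitary.2).2
      have h4 := hH.spectral_theorem
      rw [Unitary.conjStarAlgAut_apply] at h4
      convert h2 using 1
      rw [← diagonal_sub, ← smul_one_eq_diagonal, Matrix.mul_sub, Matrix.sub_mul,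
        Matrix.mul_smul, Matrix.mul_one, Matrix.smul_mul, h3]
      congr 1
    have := hB.dotProduct_mulVec_nonneg u
    simp only [star_trivial, sub_mulVec, smul_mulVec, one_mulVec, dotProduct_sub,
      dotProduct_smul, smul_eq_mul] at this
    linarith

theorem IsGroundPair.le_eigenvalue {A : Matrix ι ι ℝ} {E x : ℝ} {v u : ι → ℝ}
    (h : IsGroundPair A E v) (hu : u ≠ 0) (hx : A *ᵥ u = x • u) : E ≤ x := by
  have h1 := h.le_form u
  rw [hx, dotProduct_smul, smul_eq_mul] at h1
  have h2 : 0 < u ⬝ᵥ u := lt_of_le_of_ne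
    (Finset.sum_nonneg fun i _ => mul_self_nonneg _) (Ne.symm (by simpa using hu))
  exact le_of_mul_le_mul_right h1 h2

/-- A - E is positive semidefinite, and a vector on which a semidefinite form vanishes lies in its
kernel. -/
theorem IsGroundPair.eigen_of_form_le {A : Matrix ι ι ℝ} (hA : A.IsSymm) {E : ℝ} {v u : ι → ℝ}
    (h : IsGroundPair A E v) (hu : u ⬝ᵥ A *ᵥ u ≤ E * (u ⬝ᵥ u)) : A *ᵥ u = E • u := by
  classical
  have hB : (A - E • (1 : Matrix ι ι ℝ)).PosSemidef := by
    refine Matrix.PosSemidef.of_dotProduct_mulVec_nonneg ?_ ?_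
    · rw [Matrix.IsHermitian, Matrix.conjTranspose_eq_transpose_of_trivial, transpose_sub,
        hA.eq, transpose_smul, transpose_one]
    · intro x
      simp only [star_trivial, sub_mulVec, smul_mulVec, one_mulVec, dotProduct_sub,
        dotProduct_smul, smul_eq_mul]
      linarith [h.le_form x]
  have h1 := (hB.dotProduct_mulVec_zero_iff u).1 (by
    simp only [star_trivial, sub_mulVec, smul_mulVec, one_mulVec, dotProduct_sub,
        dotProduct_smul, smul_eq_mul]
    linarith [h.le_form u])
  rw [sub_mulVec, smul_mulVec, one_mulVec] at h1
  exact sub_eq_zero.1 h1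

theorem dotProduct_mulVec_eq_sum (A : Matrix ι ι ℝ) (u : ι → ℝ) :
    u ⬝ᵥ A *ᵥ u = ∑ i, ∑ j, u i * (A i j * u j) := by
  simp only [dotProduct, mulVec, Finset.mul_sum]

theorem Dominates.form_abs_le {B F : Matrix ι ι ℝ} (h : Dominates B F) (u : ι → ℝ) :
    |u| ⬝ᵥ B *ᵥ |u| ≤ u ⬝ᵥ F *ᵥ u := by
  rw [dotProduct_mulVec_eq_sum, dotProduct_mulVec_eq_sum]
  exact Finset.sum_le_sum fun i _ => Finset.sum_le_sum fun j _ => h.entry_le u i j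

theorem abs_dotProduct_abs (u : ι → ℝ) : |u| ⬝ᵥ |u| = u ⬝ᵥ u := by
  simp [dotProduct, Pi.abs_apply]

theorem IsGroundPair.form_eq {A : Matrix ι ι ℝ} {E : ℝ} {v : ι → ℝ}
    (h : IsGroundPair A E v) : v ⬝ᵥ A *ᵥ v = E * (v ⬝ᵥ v) := by
  rw [h.eigen, dotProduct_smul, smul_eq_mul]

/-- Variational principle for B with trial vector |f|, which has the same norm as f. -/
theorem Dominates.groundEnergy_le {B F : Matrix ι ι ℝ} (h : Dominates B F) {EB EF : ℝ}
    {b f : ι → ℝ} (hB : IsGroundPair B EB b) (hF : IsGroundPair F EF f) : EB ≤ EF := by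
  have h1 := hB.le_form |f|
  have h2 := h.form_abs_le f
  rw [hF.form_eq] at h2
  rw [abs_dotProduct_abs] at h1
  have h3 : 0 < f ⬝ᵥ f := lt_of_le_of_ne
    (Finset.sum_nonneg fun i _ => mul_self_nonneg _) (Ne.symm (by simpa using hF.ne_zero))
  exact le_of_mul_le_mul_right (h1.trans h2) h3

/-- If the two ground-state energies agree, then taking absolute values does not change any
term of the energy of the ground state. -/
theorem Dominates.entry_eq_of_groundEnergy_eq {B F : Matrix ι ι ℝ} (h : Dominates B F) {E : ℝ}
    {b f : ι → ℝ} (hB : IsGroundPair B E b) (hF : IsGroundPair F E f) (i j : ι) :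
    |f i| * (B i j * |f j|) = f i * (F i j * f j) := by
  have h1 := hB.le_form |f|
  rw [abs_dotProduct_abs, ← hF.form_eq] at h1
  have h2 : |f| ⬝ᵥ B *ᵥ |f| = f ⬝ᵥ F *ᵥ f := le_antisymm (h.form_abs_le f) h1
  rw [dotProduct_mulVec_eq_sum, dotProduct_mulVec_eq_sum] at h2
  have h3 := (Finset.sum_eq_sum_iff_of_le fun i _ =>
    Finset.sum_le_sum fun j _ => h.entry_le f i j).1 h2 i (Finset.mem_univ i)
  exact (Finset.sum_eq_sum_iff_of_le fun j _ => h.entry_le f i j).1 h3 j (Finset.mem_univ j)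

/-- The Perron-Frobenius step: |f| is an eigenvector of B, and where f vanishes its eigenvalue
equation says that a sum of nonpositive terms is zero. Each term is then zero, so zeros of f spread
along negative entries of B. -/
theorem Dominates.zero_of_groundEnergy_eq {B F : Matrix ι ι ℝ} (h : Dominates B F)
    (hBs : B.IsSymm) {E : ℝ}
    {b f : ι → ℝ} (hB : IsGroundPair B E b) (hF : IsGroundPair F E f) {i j : ι}
    (hij : B i j < 0) (hi : f i = 0) : f j = 0 := by
  have h1 : B *ᵥ |f| = E • |f| := hB.eigen_of_form_le hBs (by
    rw [abs_dotProduct_abs, ← hF.form_eq]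
    exact h.form_abs_le f)
  have h2 := congrFun h1 i
  simp only [mulVec, dotProduct, Pi.smul_apply, Pi.abs_apply, hi, abs_zero, smul_zero] at h2
  have h3 : ∀ k ∈ Finset.univ, B i k * |f k| ≤ 0 := by
    intro k _
    by_cases hk : i = k
    · simp [← hk, hi]
    · have := h.off_diag i k hk
      exact mul_nonpos_of_nonpos_of_nonneg (by linarith [abs_nonneg (F i k)]) (abs_nonneg _)
  have h4 := (Finset.sum_eq_zero_iff_of_nonpos h3).1 h2 j (Finset.mem_univ j)
  simpa [hij.ne] using h4

end Matrices

/-! ### From operators on Fock space to real matrices -/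

section Representation

variable {ι X : Type*} [Fintype ι]

/-- The state with amplitudes `v` on the basis states labelled by `e`. -/
noncomputable def stateOf (e : ι → X) (v : ι → ℂ) : X →₀ ℂ := ∑ i, v i • Finsupp.single (e i) 1

theorem stateOf_apply {e : ι → X} (he : Function.Injective e) (v : ι → ℂ) (j : ι) :
    stateOf e v (e j) = v j := by
  classical
  simp [stateOf, Finsupp.finsetSum_apply, Finsupp.single_apply, he.eq_iff]

theorem stateOf_mem (e : ι → X) (v : ι → ℂ) :
    stateOf e v ∈ Finsupp.supported ℂ ℂ (Set.range e) :=
  Submodule.sum_mem _ fun i _ => Submodule.smul_mem _ _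
    (Finsupp.single_mem_supported ℂ 1 (Set.mem_range_self i))

theorem stateOf_comp {e : ι → X} (he : Function.Injective e) {ψ : X →₀ ℂ}
    (hψ : ψ ∈ Finsupp.supported ℂ ℂ (Set.range e)) : stateOf e (ψ ∘ e) = ψ := by
  ext x
  by_cases hx : x ∈ Set.range e
  · obtain ⟨i, rfl⟩ := hx
    exact stateOf_apply he _ i
  · rw [(Finsupp.mem_supported' ℂ _).1 (stateOf_mem e _) x hx,
      (Finsupp.mem_supported' ℂ _).1 hψ x hx]

/-- The operator `H` acts on the basis states labelled by `e` through the real matrix `K`. -/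
def ActsBy (H : Module.End ℂ (X →₀ ℂ)) (e : ι → X) (K : Matrix ι ι ℝ) : Prop :=
  ∀ i, H (Finsupp.single (e i) 1) = ∑ j, (K j i : ℂ) • Finsupp.single (e j) 1

theorem ActsBy.apply_stateOf {H : Module.End ℂ (X →₀ ℂ)} {e : ι → X} {K : Matrix ι ι ℝ}
    (h : ActsBy H e K) (v : ι → ℂ) :
    H (stateOf e v) = stateOf e fun j => ∑ i, (K j i : ℂ) * v i := by
  simp only [stateOf, map_sum, map_smul, Finset.sum_smul]
  rw [Finset.sum_comm]
  refine Finset.sum_congr rfl fun i _ => ?_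
  rw [h i, Finset.smul_sum]
  exact Finset.sum_congr rfl fun j _ => by rw [smul_smul, mul_comm]

/-- Since K and the eigenvalue are real, the real and imaginary parts of a complex eigenvector
satisfy the same equation and at least one is nonzero. Real vectors therefore suffice to bound the
spectrum. -/
theorem ActsBy.isGroundStateEnergy {H : Module.End ℂ (X →₀ ℂ)} {e : ι → X}
    {K : Matrix ι ι ℝ} (h : ActsBy H e K) (he : Function.Injective e) {E : ℝ} {v : ι → ℝ}
    (hv : IsGroundPair K E v) :
    IsGroundStateEnergy H (Finsupp.supported ℂ ℂ (Set.range e)) E := by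
  constructor
  · refine ⟨stateOf e fun i => (v i : ℂ), stateOf_mem e _, ?_, ?_⟩
    · intro h0
      apply hv.ne_zero
      ext i
      have := stateOf_apply he (fun i => (v i : ℂ)) i
      rw [h0] at this
      simpa using this.symm
    · rw [h.apply_stateOf, stateOf, stateOf, Finset.smul_sum]
      refine Finset.sum_congr rfl fun j _ => ?_
      rw [smul_smul]
      congr 1
      have := congrFun hv.eigen j
      simp only [mulVec, dotProduct, Pi.smul_apply, smul_eq_mul] at this
      exact_mod_cast this
  · rintro x ⟨ψ, hψ, hne, hx⟩
    have hcomp := stateOf_comp he hψ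
    have key : ∀ j, ∑ i, (K j i : ℂ) * ψ (e i) = x * ψ (e j) := by
      intro j
      rw [← hcomp, h.apply_stateOf] at hx
      have := DFunLike.congr_fun hx (e j)
      rw [Finsupp.smul_apply, stateOf_apply he, stateOf_apply he] at this
      exact this
    have hre : K *ᵥ (fun i => (ψ (e i)).re) = x • fun i => (ψ (e i)).re := by
      ext j
      simpa [mulVec, dotProduct] using congrArg Complex.re (key j)
    have him : K *ᵥ (fun i => (ψ (e i)).im) = x • fun i => (ψ (e i)).im := by
      ext j
      simpa [mulVec, dotProduct] using congrArg Complex.im (key j)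
    by_cases h0 : (fun i => (ψ (e i)).re) = 0
    · refine hv.le_eigenvalue (fun h1 => hne ?_) him
      rw [← hcomp]
      have : ψ ∘ e = 0 := by
        ext i
        exact Complex.ext (congrFun h0 i) (congrFun h1 i)
      rw [this]
      simp only [stateOf, Pi.zero_apply, zero_smul, Finset.sum_const_zero]
    · exact hv.le_eigenvalue h0 hre

end Representation

/-! ### Matrix elements of the Hamiltonian between configurations -/

section Kernels

variable {Λ : Type*} [DecidableEq Λ]

/-- The symmetrised hopping amplitude. -/
def hopAmp (t : Λ → Λ → ℂ) (j k : Λ) : ℝ := (t j k).re + (t k j).re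

/-- A particle hops from `k ∈ s` to the empty site `j`, with resulting configuration `s'`. -/
def IsHop (j k : Λ) (s' s : Finset Λ) : Prop := k ∈ s ∧ j ∉ s ∧ s' = insert j (s.erase k)

instance (j k : Λ) (s' s : Finset Λ) : Decidable (IsHop j k s' s) := by
  unfold IsHop; infer_instance

theorem IsHop.symm {j k : Λ} {s' s : Finset Λ} (h : IsHop j k s' s) : IsHop k j s s' := by
  obtain ⟨hk, hj, rfl⟩ := h
  have hjk : j ≠ k := fun h => hj (h ▸ hk)
  refine ⟨by simp, by simp [hjk.symm], ?_⟩
  rw [Finset.erase_insert (by simp [hj]), Finset.insert_erase hk]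

theorem IsHop.erase_eq {j k : Λ} {s' s : Finset Λ} (h : IsHop j k s' s) :
    s'.erase j = s.erase k := by
  obtain ⟨hk, hj, rfl⟩ := h
  rw [Finset.erase_insert (by simp [hj])]

theorem IsHop.card_eq {j k : Λ} {s' s : Finset Λ} (h : IsHop j k s' s) : s'.card = s.card := by
  obtain ⟨hk, hj, rfl⟩ := h
  rw [Finset.card_insert_of_notMem (by simp [hj]), Finset.card_erase_add_one hk]

theorem IsHop.ne {j k : Λ} {s' s : Finset Λ} (h : IsHop j k s' s) : s' ≠ s := by
  obtain ⟨hk, hj, rfl⟩ := h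
  exact fun h => hj (h ▸ Finset.mem_insert_self _ _)

/-- Ensures that the double sum in `configKernel` has at most one nonzero term. -/
theorem IsHop.unique {j k j' k' : Λ} {s' s : Finset Λ} (h : IsHop j k s' s)
    (h' : IsHop j' k' s' s) : j' = j ∧ k' = k := by
  have key : ∀ {a b a' b' : Λ} {r' r : Finset Λ}, IsHop a b r' r → IsHop a' b' r' r → a' = a := by
    rintro a b a' b' r' r ⟨-, -, rfl⟩ ⟨-, h2, h3⟩
    have := h3 ▸ Finset.mem_insert_self a' _
    simp only [Finset.mem_insert, Finset.mem_erase, h2, and_false, or_false] at this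
    exact this
  exact ⟨key h h', key h.symm h'.symm⟩

variable [Fintype Λ]

/-- The potential energy of a configuration. -/
def potential (μ : Λ → ℝ) (V : Λ → Λ → ℝ) (s : Finset Λ) : ℝ :=
  -(∑ j, if j ∈ s then μ j else 0) + ∑ j, ∑ k, if j ∈ s ∧ k ∈ s then V j k else 0

/-- The matrix, in the basis of configurations, of a Hamiltonian with potential energy `D` and
hopping matrix elements `-T j k * w j k R`, where `R` is the configuration of the particles that
do not move. -/
def configKernel (T : Λ → Λ → ℝ) (D : Finset Λ → ℝ) (w : Λ → Λ → Finset Λ → ℝ) :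
    Matrix (Finset Λ) (Finset Λ) ℝ := fun s' s =>
  (if s' = s then D s else 0)
    - ∑ j, ∑ k, if IsHop j k s' s then T j k * w j k (s.erase k) else 0

theorem configKernel_diag (T : Λ → Λ → ℝ) (D : Finset Λ → ℝ) (w : Λ → Λ → Finset Λ → ℝ)
    (s : Finset Λ) : configKernel T D w s s = D s := by
  simp only [configKernel, if_true]
  rw [Finset.sum_eq_zero, sub_zero]
  exact fun j _ => Finset.sum_eq_zero fun k _ => if_neg fun h => h.ne rfl

theorem configKernel_hop (T : Λ → Λ → ℝ) (D : Finset Λ → ℝ) (w : Λ → Λ → Finset Λ → ℝ)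
    {j k : Λ} {s' s : Finset Λ} (h : IsHop j k s' s) :
    configKernel T D w s' s = -(T j k * w j k (s.erase k)) := by
  simp only [configKernel, if_neg h.ne, zero_sub]
  rw [Finset.sum_eq_single j, Finset.sum_eq_single k, if_pos h]
  · exact fun k' _ hk' => if_neg fun h' => hk' (h.unique h').2
  · simp
  · exact fun j' _ hj' => Finset.sum_eq_zero fun k' _ => if_neg fun h' => hj' (h.unique h').1
  · simp

theorem configKernel_eq_zero (T : Λ → Λ → ℝ) (D : Finset Λ → ℝ) (w : Λ → Λ → Finset Λ → ℝ)
    {s' s : Finset Λ} (hne : s' ≠ s) (h : ∀ j k, ¬ IsHop j k s' s) :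
    configKernel T D w s' s = 0 := by
  simp [configKernel, hne, h]

theorem configKernel_isSymm {T : Λ → Λ → ℝ} (D : Finset Λ → ℝ) {w : Λ → Λ → Finset Λ → ℝ}
    (hT : ∀ j k, T j k = T k j) (hw : ∀ j k R, w j k R = w k j R) :
    (configKernel T D w).IsSymm := by
  refine Matrix.IsSymm.ext fun s s' => ?_
  by_cases hne : s' = s
  · rw [hne]
  by_cases h : ∃ j k, IsHop j k s' s
  · obtain ⟨j, k, h⟩ := h
    rw [configKernel_hop T D w h, configKernel_hop T D w h.symm, hT, hw, h.erase_eq]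
  · push Not at h
    rw [configKernel_eq_zero T D w hne h,
      configKernel_eq_zero T D w (Ne.symm hne) fun j k h' => h k j h'.symm]

theorem configKernel_eq_zero_of_card_ne (T : Λ → Λ → ℝ) (D : Finset Λ → ℝ)
    (w : Λ → Λ → Finset Λ → ℝ) {s' s : Finset Λ} (h : s'.card ≠ s.card) :
    configKernel T D w s' s = 0 :=
  configKernel_eq_zero T D w (fun h' => h (h' ▸ rfl)) fun _ _ h' => h h'.card_eq

theorem configKernel_dominates {T : Λ → Λ → ℝ} (D : Finset Λ → ℝ) {w : Λ → Λ → Finset Λ → ℝ}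
    (hT : ∀ j k, 0 ≤ T j k) (hw : ∀ j k R, |w j k R| ≤ 1) :
    Dominates (configKernel T D fun _ _ _ => 1) (configKernel T D w) := by
  refine ⟨fun s => by rw [configKernel_diag, configKernel_diag], fun s' s hne => ?_⟩
  by_cases h : ∃ j k, IsHop j k s' s
  · obtain ⟨j, k, h⟩ := h
    rw [configKernel_hop T D w h, configKernel_hop T D (fun _ _ _ => 1) h, abs_neg, abs_mul, neg_neg,
      abs_of_nonneg (hT j k)]
    exact mul_le_mul_of_nonneg_left (hw _ _ _) (hT j k)
  · push Not at h
    rw [configKernel_eq_zero T D w hne h, configKernel_eq_zero T D (fun _ _ _ => 1) hne h]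
    simp

/-- The action of a Hamiltonian on a basis state, from the action of the one-particle hopping and
number operators. -/
theorem map_hamiltonian_apply {W : Type*} [AddCommGroup W] [Module ℂ W]
    (c cd : Λ → Module.End ℂ W) {t : Λ → Λ → ℂ} (μ : Λ → ℝ) (V : Λ → Λ → ℝ)
    (ht_diag : ∀ j, t j j = 0) (ht_real : ∀ j k, (t j k).im = 0)
    (Q : Module.End ℂ W) (e : Finset Λ → W) (w : Λ → Λ → Finset Λ → ℝ) (s : Finset Λ)
    (hQ : Q (e s) = e s)
    (hnum : ∀ j, cd j (c j (e s)) = if j ∈ s then e s else 0)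
    (hhop : ∀ j k, j ≠ k → Q (cd j (c k (e s))) =
      if k ∈ s ∧ j ∉ s then (w j k (s.erase k) : ℂ) • e (insert j (s.erase k)) else 0) :
    Q (hamiltonian c cd t μ V (e s)) =
      ∑ s', (configKernel (hopAmp t) (potential μ V) w s' s : ℂ) • e s' := by
  have ht : ∀ j k, t j k = ((t j k).re : ℂ) := fun j k =>
    Complex.ext (by simp) (by simp [ht_real])
  have h1 : Q ((∑ j, ∑ k, (t j k • (cd j * c k) + (starRingEnd ℂ) (t j k) • (cd k * c j))) (e s))
      = ∑ j, ∑ k, ((hopAmp t j k : ℝ) : ℂ) •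
        (if k ∈ s ∧ j ∉ s then (w j k (s.erase k) : ℂ) • e (insert j (s.erase k)) else 0) := by
    have hc : ∀ j k, (starRingEnd ℂ) (t j k) = t j k := fun j k => by
      rw [ht j k]; exact Complex.conj_ofReal _
    simp only [hc, LinearMap.sum_apply, LinearMap.add_apply, LinearMap.smul_apply,
      Module.End.mul_apply, map_sum, map_add, map_smul, Finset.sum_add_distrib]
    -- Relabelling j ↔ k in the Hermitian conjugate terms collects the coefficient t_jk + t_kj.
    rw [Finset.sum_comm (f := fun j k => t j k • Q (cd k (c j (e s)))),
      ← Finset.sum_add_distrib]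
    refine Finset.sum_congr rfl fun j _ => ?_
    rw [← Finset.sum_add_distrib]
    refine Finset.sum_congr rfl fun k _ => ?_
    rw [← add_smul]
    -- Terms with j = k drop out because t_jj = 0, so `hhop` is needed only for distinct sites.
    by_cases hjk : j = k
    · subst hjk
      simp [ht_diag, hopAmp]
    · rw [hhop j k hjk, ht j k, ht k j]
      simp [hopAmp]
  have h2 : Q ((∑ j, (μ j : ℂ) • (cd j * c j)) (e s)) =
      ((∑ j, if j ∈ s then μ j else 0 : ℝ) : ℂ) • e s := by
    simp only [LinearMap.sum_apply, LinearMap.smul_apply, Module.End.mul_apply, map_sum, map_smul,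
      hnum, Complex.ofReal_sum, Finset.sum_smul]
    refine Finset.sum_congr rfl fun j _ => ?_
    split_ifs <;> simp [hQ]
  have h3 : Q ((∑ j, ∑ k, (V j k : ℂ) • ((cd j * c j) * (cd k * c k))) (e s)) =
      ((∑ j, ∑ k, if j ∈ s ∧ k ∈ s then V j k else 0 : ℝ) : ℂ) • e s := by
    simp only [LinearMap.sum_apply, LinearMap.smul_apply, Module.End.mul_apply, map_sum, map_smul,
      hnum, Complex.ofReal_sum, Finset.sum_smul]
    refine Finset.sum_congr rfl fun j _ => Finset.sum_congr rfl fun k _ => ?_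
    by_cases hk : k ∈ s <;> by_cases hj : j ∈ s <;> simp [hk, hj, hnum, hQ]
  have h4 : ∑ s', (configKernel (hopAmp t) (potential μ V) w s' s : ℂ) • e s' =
      (potential μ V s : ℂ) • e s - ∑ j, ∑ k, ((hopAmp t j k : ℝ) : ℂ) •
        (if k ∈ s ∧ j ∉ s then (w j k (s.erase k) : ℂ) • e (insert j (s.erase k)) else 0) := by
    simp only [configKernel, Complex.ofReal_sub, sub_smul, Finset.sum_sub_distrib,
      Complex.ofReal_sum, Finset.sum_smul]
    congr 1
    · rw [Finset.sum_eq_single s]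
      · simp
      · intro s' _ hs'; simp [hs']
      · simp
    · rw [Finset.sum_comm]
      refine Finset.sum_congr rfl fun j _ => ?_
      rw [Finset.sum_comm]
      refine Finset.sum_congr rfl fun k _ => ?_
      rw [Finset.sum_eq_single (insert j (s.erase k))]
      · by_cases h : k ∈ s ∧ j ∉ s
        · have h' : IsHop j k (insert j (s.erase k)) s := ⟨h.1, h.2, rfl⟩
          rw [if_pos h, if_pos h', smul_smul, Complex.ofReal_mul]
        · have h' : ¬ IsHop j k (insert j (s.erase k)) s := fun h' => h ⟨h'.1, h'.2.1⟩
          rw [if_neg h, if_neg h', smul_zero, Complex.ofReal_zero, zero_smul]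
      · intro s' _ hs'
        rw [if_neg fun h' => hs' h'.2.2, Complex.ofReal_zero, zero_smul]
      · simp
  rw [h4, hamiltonian, LinearMap.add_apply, LinearMap.sub_apply, LinearMap.neg_apply, map_add,
    map_sub, map_neg, h1, h2, h3, potential, Complex.ofReal_add, add_smul, Complex.ofReal_neg,
    neg_smul]
  abel

end Kernels

/-! ### Fermionic matrix elements and their signs -/

section Fermions

variable {Λ : Type*} [LinearOrder Λ]

/-- The fermionic sign, as a real number. -/
def fermiSignReal (j : Λ) (s : Finset Λ) : ℝ := (-1) ^ (s.filter (fun i => i < j)).card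

theorem fermiSign_eq (j : Λ) (s : Finset Λ) : fermiSign j s = (fermiSignReal j s : ℂ) := by
  simp [fermiSign, fermiSignReal]

theorem fermiSignReal_mul_self (j : Λ) (s : Finset Λ) :
    fermiSignReal j s * fermiSignReal j s = 1 := by
  rw [fermiSignReal, ← mul_pow]; simp

theorem abs_fermiSignReal (j : Λ) (s : Finset Λ) : |fermiSignReal j s| = 1 := by
  simp [fermiSignReal, abs_pow]

theorem fermiSignReal_insert (i j : Λ) {s : Finset Λ} (hi : i ∉ s) :
    fermiSignReal j (insert i s) = (if i < j then -1 else 1) * fermiSignReal j s := by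
  unfold fermiSignReal
  rw [Finset.filter_insert]
  split_ifs with h
  · rw [Finset.card_insert_of_notMem (by simp [hi]), pow_succ, mul_comm]
  · rw [one_mul]

theorem fermiSignReal_erase_self (j : Λ) (s : Finset Λ) :
    fermiSignReal j (s.erase j) = fermiSignReal j s := by
  by_cases hj : j ∈ s
  · conv_rhs => rw [← Finset.insert_erase hj, fermiSignReal_insert _ _ (by simp)]
    simp
  · rw [Finset.erase_eq_of_notMem hj]

/-- The sign of the fermionic hopping from `k` to `j` in the presence of particles at `R`. -/
def fermiHopSign (j k : Λ) (R : Finset Λ) : ℝ := fermiSignReal j R * fermiSignReal k R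

theorem abs_fermiHopSign_le (j k : Λ) (R : Finset Λ) : |fermiHopSign j k R| ≤ 1 := by
  rw [fermiHopSign, abs_mul, abs_fermiSignReal, abs_fermiSignReal, one_mul]

theorem fermiHopSign_comm (j k : Λ) (R : Finset Λ) : fermiHopSign j k R = fermiHopSign k j R :=
  mul_comm _ _

/-- A site does not precede itself, so both signs can be read off from `s.erase k`, the particles at
rest. The condition `j ∉ s.erase k` also admits j = k, which gives the number operator. -/
theorem fermiCre_fermiAnn_single (j k : Λ) (s : Finset Λ) :
    fermiCre j (fermiAnn k (Finsupp.single s 1)) =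
      if k ∈ s ∧ j ∉ s.erase k then
        (fermiHopSign j k (s.erase k) : ℂ) • Finsupp.single (insert j (s.erase k)) 1 else 0 := by
  by_cases hk : k ∈ s
  · by_cases hj : j ∈ s.erase k
    · simp [fermiAnn, fermiCre, Finsupp.linearCombination_single, hk, hj]
    · simp only [fermiAnn, fermiCre, Finsupp.linearCombination_single, hk, hj, one_smul, if_true,
        if_false, not_false_eq_true, and_self, fermiSign_eq, fermiHopSign,
        fermiSignReal_erase_self, Finsupp.smul_single]
      congr 1
      simp [mul_comm]
  · simp [fermiAnn, Finsupp.linearCombination_single, hk]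

theorem fermiHam_single [Fintype Λ] {t : Λ → Λ → ℂ} (μ : Λ → ℝ) (V : Λ → Λ → ℝ)
    (ht_diag : ∀ j, t j j = 0) (ht_real : ∀ j k, (t j k).im = 0) (s : Finset Λ) :
    fermiHam t μ V (Finsupp.single s 1) =
      ∑ s', (configKernel (hopAmp t) (potential μ V) fermiHopSign s' s : ℂ) •
        Finsupp.single s' 1 := by
  refine map_hamiltonian_apply fermiAnn fermiCre μ V ht_diag ht_real LinearMap.id
    (fun s => Finsupp.single s 1) fermiHopSign s rfl (fun j => ?_) fun j k hjk => ?_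
  · rw [fermiCre_fermiAnn_single]
    by_cases hj : j ∈ s
    · simp [hj, fermiHopSign, fermiSignReal_mul_self, Finset.insert_erase hj]
    · simp [hj]
  · rw [LinearMap.id_apply, fermiCre_fermiAnn_single]
    simp [hjk]

end Fermions

/-! ### Hard-core bosonic matrix elements -/

section Bosons

variable {Λ : Type*} [DecidableEq Λ]

/-- The occupation numbers of the hard-core configuration with occupied sites `s`. -/
def occupation (s : Finset Λ) (j : Λ) : ℕ := if j ∈ s then 1 else 0

theorem occupation_injective : Function.Injective (occupation (Λ := Λ)) := by
  intro s s' h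
  ext j
  have := congrFun h j
  simp only [occupation] at this
  split_ifs at this <;> simp_all

theorem occupation_mem (s : Finset Λ) : occupation s ∈ hardCoreConfigs Λ := by
  intro j
  unfold occupation
  split_ifs <;> simp

theorem exists_occupation [Fintype Λ] {n : Λ → ℕ} (hn : n ∈ hardCoreConfigs Λ) : ∃ s, occupation s = n := by
  refine ⟨Finset.univ.filter fun j => n j = 1, ?_⟩
  ext j
  have := hn j
  simp only [occupation, Finset.mem_filter, Finset.mem_univ, true_and]
  split_ifs <;> omega

theorem sum_occupation [Fintype Λ] (s : Finset Λ) : ∑ j, occupation s j = s.card := by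
  simp [occupation]

theorem occupation_sub_single {k : Λ} {s : Finset Λ} :
    occupation s - Pi.single k 1 = occupation (s.erase k) := by
  ext j
  by_cases h : j = k
  · subst h; by_cases hj : j ∈ s <;> simp [occupation, hj]
  · simp [occupation, h]

theorem occupation_add_single {j : Λ} {s : Finset Λ} (hj : j ∉ s) :
    occupation s + Pi.single j 1 = occupation (insert j s) := by
  ext i
  by_cases h : i = j
  · subst h; simp [occupation, hj]
  · simp [occupation, h]

theorem hardCoreProj_single_occupation (s : Finset Λ) :
    hardCoreProj Λ (Finsupp.single (occupation s) 1) = Finsupp.single (occupation s) 1 := by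
  simp [hardCoreProj, Finsupp.linearCombination_single, occupation_mem]

theorem boseAnn_single (k : Λ) (s : Finset Λ) :
    boseAnn k (Finsupp.single (occupation s) 1) =
      if k ∈ s then Finsupp.single (occupation (s.erase k)) 1 else 0 := by
  rw [boseAnn, Finsupp.linearCombination_single, occupation_sub_single]
  by_cases hk : k ∈ s <;> simp [occupation, hk]

theorem boseCre_single {j : Λ} {s : Finset Λ} (hj : j ∉ s) :
    boseCre j (Finsupp.single (occupation s) 1) = Finsupp.single (occupation (insert j s)) 1 := by
  rw [boseCre, Finsupp.linearCombination_single, occupation_add_single hj]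
  simp [occupation, hj]

theorem hardCoreProj_boseCre_single {j : Λ} {s : Finset Λ} (hj : j ∈ s) :
    hardCoreProj Λ (boseCre j (Finsupp.single (occupation s) 1)) = 0 := by
  have h : occupation s + Pi.single j 1 ∉ hardCoreConfigs Λ := fun h => by
    have := h j
    simp [occupation, hj] at this
  rw [boseCre, Finsupp.linearCombination_single, one_smul, hardCoreProj,
    Finsupp.linearCombination_single, if_neg h, smul_zero]

theorem hardCoreHam_single [Fintype Λ] {t : Λ → Λ → ℂ} (μ : Λ → ℝ) (V : Λ → Λ → ℝ)
    (ht_diag : ∀ j, t j j = 0) (ht_real : ∀ j k, (t j k).im = 0) (s : Finset Λ) :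
    hardCoreHam t μ V (Finsupp.single (occupation s) 1) =
      ∑ s', (configKernel (hopAmp t) (potential μ V) (fun _ _ _ => 1) s' s : ℂ) •
        Finsupp.single (occupation s') 1 := by
  rw [hardCoreHam, Module.End.mul_apply, Module.End.mul_apply, hardCoreProj_single_occupation]
  -- A hop onto an occupied site leaves the hard-core space, and the outer projection removes it;
  -- all remaining square roots equal 1.
  refine map_hamiltonian_apply boseAnn boseCre μ V ht_diag ht_real (hardCoreProj Λ)
    (fun s => Finsupp.single (occupation s) 1) _ s (hardCoreProj_single_occupation s)
    (fun j => ?_) fun j k hjk => ?_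
  · rw [boseAnn_single]
    split_ifs with hj
    · rw [boseCre_single (by simp), Finset.insert_erase hj]
    · rw [map_zero]
  · rw [boseAnn_single]
    by_cases hk : k ∈ s
    · by_cases hj : j ∈ s
      · rw [if_pos hk, hardCoreProj_boseCre_single (by simp [hj, hjk])]
        simp [hj]
      · rw [if_pos hk, boseCre_single (by simp [hj]), hardCoreProj_single_occupation]
        simp [hj, hk]
    · simp [hk]

end Bosons

/-! ### Connectedness of the configuration space -/

section Configurations

variable {Λ : Type*} [DecidableEq Λ]

/-- Transports a particle along a walk that may meet occupied sites. Quantifying over all `s` lets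
the induction treat the remaining walk from a modified configuration. -/
theorem exchange_of_walk {G : SimpleGraph Λ} {P : Finset Λ → Prop}
    (hP : ∀ s i k, i ∈ s → k ∉ s → G.Adj i k → P s → P (insert k (s.erase i)))
    {i k : Λ} (p : G.Walk i k) :
    ∀ s : Finset Λ, i ∈ s → k ∉ s → P s → P (insert k (s.erase i)) := by
  induction p with
  | nil => exact fun s hi hk => absurd hi hk
  | @cons i m k hadj p ih =>
    intro s hi hk hs
    have him : i ≠ m := hadj.ne
    by_cases hms : m ∈ s
    · have hik : i ≠ k := fun h => hk (h ▸ hi)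
      have hmk : m ≠ k := fun h => hk (h ▸ hms)
      -- The next site m is occupied: its particle goes to k first, then the one at i moves into m.
      -- Particles being indistinguishable, only the occupied set matters.
      have h1 := hP _ i m (by simp [hi, him]) (by simp [hmk]) hadj (ih s hms hk hs)
      convert h1 using 1
      ext x
      simp only [Finset.mem_insert, Finset.mem_erase]
      grind
    · have h1 := hP s i m hi hms hadj hs
      by_cases hmk : m = k
      · exact hmk ▸ h1
      · clear hP
        have h2 := ih _ (by simp) (by simp [Ne.symm hmk, hk]) h1
        convert h2 using 1
        ext x
        simp only [Finset.mem_insert, Finset.mem_erase]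
        grind

/-- On a connected graph, any two configurations with the same number of particles are related by
hops along edges into empty sites. -/
theorem forall_configs_of_connected {G : SimpleGraph Λ} (hG : G.Connected)
    {P : Finset Λ → Prop}
    (hP : ∀ s i k, i ∈ s → k ∉ s → G.Adj i k → P s → P (insert k (s.erase i)))
    {s s' : Finset Λ} (hcard : s.card = s'.card) (hs : P s) : P s' := by
  induction hn : (s \ s').card generalizing s with
  | zero =>
    have : s ⊆ s' := by
      rwa [Finset.card_eq_zero, Finset.sdiff_eq_empty_iff_subset] at hn
    exact Finset.eq_of_subset_of_card_le this hcard.ge ▸ hs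
  | succ n ih =>
    have hn' : (s' \ s).card = n + 1 := by
      rw [← hn]; exact (Finset.card_sdiff_comm hcard).symm
    obtain ⟨i, hi⟩ := Finset.card_pos.1 (by omega : 0 < (s \ s').card)
    obtain ⟨k, hk⟩ := Finset.card_pos.1 (by omega : 0 < (s' \ s).card)
    rw [Finset.mem_sdiff] at hi hk
    obtain ⟨p⟩ := hG.preconnected i k
    refine ih (s := insert k (s.erase i)) ?_
      (exchange_of_walk hP p s hi.1 hk.2 hs) ?_
    · rw [Finset.card_insert_of_notMem (by simp [hk.2]), Finset.card_erase_add_one hi.1, hcard]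
    · have h1 : insert k (s.erase i) \ s' = (s \ s').erase i := by
        rw [Finset.insert_sdiff_of_mem _ hk.1, Finset.erase_sdiff_comm]
      rw [h1, Finset.card_erase_of_mem (by simp [hi]), hn]
      rfl

end Configurations

/-! ### Sign obstruction from exchanging two fermions -/

section Exchange

variable {Λ : Type*} [LinearOrder Λ]

/-- The amplitude of `g` for fermions created at `y` and then at `x`, in the presence of
particles at `R`. -/
def orderedAmp (g : Finset Λ → ℝ) (R : Finset Λ) (x y : Λ) : ℝ :=
  g (insert x (insert y R)) * (fermiSignReal y R * fermiSignReal x (insert y R))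

/-- Anticommutation: in the order of sites exactly one of x, y precedes the other, so exactly one of
the two creation orders picks up an extra -1. -/
theorem orderedAmp_swap (g : Finset Λ → ℝ) {R : Finset Λ} {x y : Λ} (hxy : x ≠ y)
    (hx : x ∉ R) (hy : y ∉ R) : orderedAmp g R y x = -orderedAmp g R x y := by
  unfold orderedAmp
  rw [Finset.insert_comm y x, fermiSignReal_insert x y hx, fermiSignReal_insert y x hy]
  rcases hxy.lt_or_gt with h | h
  · rw [if_pos h, if_neg h.not_gt]; ring
  · rw [if_neg h.not_gt, if_pos h]; ring

/-- The sign of y occurs squared, so moving a particle from x to z with y fixed costs just the hop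
sign. -/
theorem orderedAmp_mul (g : Finset Λ → ℝ) {R : Finset Λ} {x y z : Λ} :
    orderedAmp g R z y * orderedAmp g R x y = fermiHopSign z x (insert y R) *
      (g (insert z (insert y R)) * g (insert x (insert y R))) := by
  unfold orderedAmp fermiHopSign
  linear_combination (fermiSignReal z (insert y R) * fermiSignReal x (insert y R) *
    (g (insert z (insert y R)) * g (insert x (insert y R)))) * fermiSignReal_mul_self y R

/-- No amplitude can gain a positive sign from every fermionic hop if two particles can be
exchanged around a site with three neighbours. -/
theorem no_positive_fermi_amplitude [Fintype Λ] {G : SimpleGraph Λ} {M : ℕ} {j a b c : Λ}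
    (ha : G.Adj j a) (hb : G.Adj j b) (hc : G.Adj j c) (hab : a ≠ b) (hac : a ≠ c) (hbc : b ≠ c)
    (hM : 2 ≤ M) (hMN : M + 2 ≤ Fintype.card Λ) (g : Finset Λ → ℝ)
    (hg : ∀ j k s' s, G.Adj j k → s.card = M → IsHop j k s' s →
      0 < fermiHopSign j k (s.erase k) * (g s' * g s)) : False := by
  -- M - 2 spectators sit off the star, which has at most four sites; this is where M ≤ N - 2
  -- enters.
  have hcard : M - 2 ≤ (({j, a, b, c} : Finset Λ)ᶜ).card := by
    rw [Finset.card_compl]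
    have := Finset.card_le_four (a := j) (b := a) (c := b) (d := c)
    omega
  obtain ⟨R, hR, hRc⟩ := Finset.exists_subset_card_eq hcard
  have hout : ∀ x ∈ ({j, a, b, c} : Finset Λ), x ∉ R := fun x hx hxR =>
    Finset.mem_compl.1 (hR hxR) hx
  have hjR := hout j (by simp)
  have haR := hout a (by simp)
  have hbR := hout b (by simp)
  have hcR := hout c (by simp)
  have step : ∀ {x y z : Λ}, G.Adj z x → x ≠ y → z ≠ y → x ∉ R → y ∉ R → z ∉ R →
      0 < orderedAmp g R z y * orderedAmp g R x y := by
    intro x y z hadj hxy hzy hx hy hz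
    have hxs : x ∉ insert y R := by simp [hxy, hx]
    have hzs : z ∉ insert y R := by simp [hzy, hz]
    rw [orderedAmp_mul]
    have := hg z x (insert z (insert y R)) (insert x (insert y R)) hadj
      (by rw [Finset.card_insert_of_notMem hxs, Finset.card_insert_of_notMem hy, hRc]; omega)
      ⟨by simp, by simp [hadj.ne, hzy, hz], by rw [Finset.erase_insert hxs]⟩
    rwa [Finset.erase_insert hxs] at this
  have trans : ∀ {u v w : ℝ}, 0 < u * v → 0 < v * w → 0 < u * w := by
    intro u v w h1 h2
    have h3 : 0 < (v * v) * (u * w) := by linarith [mul_pos h1 h2]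
    exact pos_of_mul_pos_right h3 (mul_self_nonneg v)
  -- One particle rests on a leaf while the other passes through j between the two remaining leaves.
  -- Doing this for each resting leaf closes the exchange cycle.
  have h1 := trans (step hc.symm hb.ne hbc.symm hjR hbR hcR) (step ha hab hb.ne haR hbR hjR)
  have h2 := trans (step ha.symm hc.ne hac hjR hcR haR) (step hb hbc hc.ne hbR hcR hjR)
  have h3 := trans (step hb.symm ha.ne hab.symm hjR haR hbR) (step hc hac.symm ha.ne hcR haR hjR)
  rw [orderedAmp_swap g hbc.symm hcR hbR] at h2
  rw [orderedAmp_swap g hac haR hcR, orderedAmp_swap g hab haR hbR] at h3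
  -- Three swaps make the product of the three positive quantities equal to minus a square.
  have h4 := mul_pos (mul_pos h1 h2) h3
  nlinarith [sq_nonneg (orderedAmp g R c b * orderedAmp g R a b * orderedAmp g R a c)]

end Exchange

/-! ### Fixed particle number and strict inequality -/

section Sectors

variable {Λ : Type*}

/-- The block of a matrix belonging to the configurations with `M` particles. -/
def sectorBlock (K : Matrix (Finset Λ) (Finset Λ) ℝ) (M : ℕ) :
    Matrix {s : Finset Λ // s.card = M} {s : Finset Λ // s.card = M} ℝ :=
  K.submatrix Subtype.val Subtype.val

theorem Dominates.sectorBlock {B F : Matrix (Finset Λ) (Finset Λ) ℝ} (h : Dominates B F)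
    (M : ℕ) : Dominates (sectorBlock B M) (sectorBlock F M) :=
  ⟨fun i => h.diag i, fun i j hij => h.off_diag i j fun h => hij (Subtype.ext h)⟩

variable [Fintype Λ]

/-- Particle number is conserved, so terms outside the block vanish. -/
theorem ActsBy.sectorBlock {X : Type*} {H : Module.End ℂ (X →₀ ℂ)} {e : Finset Λ → X}
    {K : Matrix (Finset Λ) (Finset Λ) ℝ} (h : ActsBy H e K)
    (hK : ∀ s' s, s'.card ≠ s.card → K s' s = 0) (M : ℕ) :
    ActsBy H (fun s : {s : Finset Λ // s.card = M} => e s) (sectorBlock K M) := by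
  classical
  rintro ⟨s, hs⟩
  rw [h s]
  simp only [LatticeParticles.sectorBlock, submatrix_apply]
  rw [← Finset.sum_filter_add_sum_filter_not Finset.univ (fun s' : Finset Λ => s'.card = M),
    Finset.sum_eq_zero (s := Finset.univ.filter fun s' : Finset Λ => ¬ s'.card = M), add_zero]
  · exact (Finset.sum_subtype _ (by simp) fun s' : Finset Λ =>
      (K s' s : ℂ) • Finsupp.single (e s') (1 : ℂ))
  · intro s' hs'
    rw [hK s' s (by rw [hs]; simpa using hs'), Complex.ofReal_zero, zero_smul]

variable [LinearOrder Λ]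

theorem range_occupation_sector (M : ℕ) :
    Set.range (fun s : {s : Finset Λ // s.card = M} => occupation s.1) =
      {n : Λ → ℕ | n ∈ hardCoreConfigs Λ ∧ ∑ j, n j = M} := by
  ext n
  constructor
  · rintro ⟨⟨s, hs⟩, rfl⟩
    exact ⟨occupation_mem s, (sum_occupation s).trans hs⟩
  · rintro ⟨hn, hM⟩
    obtain ⟨s, rfl⟩ := exists_occupation hn
    exact ⟨⟨s, (sum_occupation s).symm.trans hM⟩, rfl⟩

theorem range_occupation : Set.range (occupation (Λ := Λ)) = hardCoreConfigs Λ := by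
  ext n
  exact ⟨fun ⟨s, hs⟩ => hs ▸ occupation_mem s, fun hn => exists_occupation hn⟩

theorem sector_groundEnergy_ne {T : Λ → Λ → ℝ} {D : Finset Λ → ℝ} {G : SimpleGraph Λ} {M : ℕ}
    (hTs : ∀ j k, T j k = T k j) (hT : ∀ j k, 0 ≤ T j k) (hTG : ∀ j k, G.Adj j k → 0 < T j k)
    (hG : G.Connected) {j : Λ} (hj : 3 ≤ (G.neighborSet j).ncard) (hM : 2 ≤ M)
    (hMN : M + 2 ≤ Fintype.card Λ) {EB EF : ℝ} {b f : {s : Finset Λ // s.card = M} → ℝ}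
    (hB : IsGroundPair (sectorBlock (configKernel T D fun _ _ _ => 1) M) EB b)
    (hF : IsGroundPair (sectorBlock (configKernel T D fermiHopSign) M) EF f) : EB ≠ EF := by
  rintro rfl
  have hdom := (configKernel_dominates D hT abs_fermiHopSign_le).sectorBlock M
  have hsymm : (sectorBlock (configKernel T D fun _ _ _ => 1) M).IsSymm :=
    (configKernel_isSymm D hTs fun _ _ _ => rfl).submatrix _
  -- One zero would spread by hops to the whole sector and force f = 0.
  have hne : ∀ s, f s ≠ 0 := by
    intro s hs
    apply hF.ne_zero
    ext s'
    have := forall_configs_of_connected hG (P := fun r => ∀ h : r.card = M, f ⟨r, h⟩ = 0)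
      (s := s.1) (s' := s'.1) ?_ (s.2.trans s'.2.symm) fun _ => hs
    · exact this s'.2
    · intro r i k hi hk hadj hr hcard
      have hop : IsHop k i (insert k (r.erase i)) r := ⟨hi, hk, rfl⟩
      refine hdom.zero_of_groundEnergy_eq hsymm hB hF (i := ⟨r, hop.card_eq.symm.trans hcard⟩)
        ?_ (hr _)
      change configKernel T D (fun _ _ _ => 1) r (insert k (r.erase i)) < 0
      rw [configKernel_hop T D _ hop.symm]
      linarith [hTG i k hadj]
  obtain ⟨S, hS, hS3⟩ := Set.exists_subset_card_eq hj
  obtain ⟨x, y, z, hxy, hxz, hyz, rfl⟩ := Set.ncard_eq_three.1 hS3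
  refine no_positive_fermi_amplitude (G := G) (j := j) (hS (by simp) : G.Adj j x)
    (hS (by simp) : G.Adj j y) (hS (by simp) : G.Adj j z) hxy hxz hyz hM hMN
    -- The extension by zero is harmless: only hops within the sector are tested.
    (fun s => if h : s.card = M then f ⟨s, h⟩ else 0) ?_
  intro j k s' s hadj hs hop
  have hs' : s'.card = M := hop.card_eq.trans hs
  have h1 := hdom.entry_eq_of_groundEnergy_eq hB hF ⟨s', hs'⟩ ⟨s, hs⟩
  simp only [sectorBlock, submatrix_apply, dif_pos hs, dif_pos hs'] at h1 ⊢
  rw [configKernel_hop T D (fun _ _ _ => 1) hop, configKernel_hop T D fermiHopSign hop] at h1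
  have h2 : 0 < T j k * (|f ⟨s', hs'⟩| * |f ⟨s, hs⟩|) :=
    mul_pos (hTG j k hadj) (mul_pos (abs_pos.2 (hne _)) (abs_pos.2 (hne _)))
  have h3 : 0 < T j k * (fermiHopSign j k (s.erase k) * (f ⟨s', hs'⟩ * f ⟨s, hs⟩)) := by
    linarith
  exact pos_of_mul_pos_right h3 (hT j k)

end Sectors

end LatticeParticles

/-! ### The theorem, by sector and grand-canonically -/

open LatticeParticles in
theorem theorem1 {Λ : Type*} [Fintype Λ] [LinearOrder Λ]
    (t : Λ → Λ → ℂ) (μ : Λ → ℝ) (V : Λ → Λ → ℝ)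
    (ht_diag : ∀ j, t j j = 0)
    (ht_real : ∀ j k, (t j k).im = 0) (ht_nonneg : ∀ j k, 0 ≤ (t j k).re) :
    (∀ M : ℕ, M ≤ Fintype.card Λ → ∃ EB EF : ℝ,
      LatticeParticles.IsGroundStateEnergy (LatticeParticles.hardCoreHam t μ V)
        (LatticeParticles.hardCoreSector Λ M) EB ∧
      LatticeParticles.IsGroundStateEnergy (LatticeParticles.fermiHam t μ V)
        (LatticeParticles.fermiSector Λ M) EF ∧
      EB ≤ EF ∧
      ((LatticeParticles.hoppingGraph t).Connected →
        (∃ j, 3 ≤ ((LatticeParticles.hoppingGraph t).neighborSet j).ncard) →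
        2 ≤ M → M + 2 ≤ Fintype.card Λ → EB < EF)) ∧
    (∃ EB EF : ℝ,
      LatticeParticles.IsGroundStateEnergy (LatticeParticles.hardCoreHam t μ V)
        (LatticeParticles.hardCoreSpace Λ) EB ∧
      LatticeParticles.IsGroundStateEnergy (LatticeParticles.fermiHam t μ V) ⊤ EF ∧
      EB ≤ EF) := by
  have hT : ∀ j k, 0 ≤ hopAmp t j k := fun j k => add_nonneg (ht_nonneg j k) (ht_nonneg k j)
  have hTs : ∀ j k, hopAmp t j k = hopAmp t k j := fun j k => add_comm _ _
  have hdom := configKernel_dominates (potential μ V) hT (abs_fermiHopSign_le (Λ := Λ))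
  have hBs : (configKernel (hopAmp t) (potential μ V) fun _ _ _ => 1).IsSymm :=
    configKernel_isSymm _ hTs fun _ _ _ => rfl
  have hFs : (configKernel (hopAmp t) (potential μ V) fermiHopSign).IsSymm :=
    configKernel_isSymm _ hTs fermiHopSign_comm
  have hB : ActsBy (hardCoreHam t μ V) occupation _ := hardCoreHam_single μ V ht_diag ht_real
  have hF : ActsBy (fermiHam t μ V) id _ := fermiHam_single μ V ht_diag ht_real
  constructor
  · intro M hM
    -- M ≤ N makes the sector nonempty, so a lowest eigenvalue exists.
    obtain ⟨s, -, hs⟩ := Finset.exists_subset_card_eq (s := (Finset.univ : Finset Λ)) hM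
    have : Nonempty {s : Finset Λ // s.card = M} := ⟨⟨s, hs⟩⟩
    obtain ⟨EB, b, hb⟩ := exists_isGroundPair (hBs.submatrix Subtype.val :
      (sectorBlock (configKernel (hopAmp t) (potential μ V) fun _ _ _ => 1) M).IsSymm)
    obtain ⟨EF, f, hf⟩ := exists_isGroundPair (hFs.submatrix Subtype.val :
      (sectorBlock (configKernel (hopAmp t) (potential μ V) fermiHopSign) M).IsSymm)
    have hle := (hdom.sectorBlock M).groundEnergy_le hb hf
    refine ⟨EB, EF, ?_, ?_, hle, ?_⟩
    · have := (hB.sectorBlock (fun _ _ => configKernel_eq_zero_of_card_ne _ _ _)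
        M).isGroundStateEnergy (occupation_injective.comp Subtype.val_injective) hb
      rwa [range_occupation_sector] at this
    · have := (hF.sectorBlock (fun _ _ => configKernel_eq_zero_of_card_ne _ _ _)
        M).isGroundStateEnergy Subtype.val_injective hf
      simp only [id_eq, Subtype.range_coe_subtype] at this
      exact this
    · rintro hconn ⟨j, hj⟩ h2 hMN
      refine lt_of_le_of_ne hle (sector_groundEnergy_ne hTs hT ?_ hconn hj h2 hMN hb hf)
      intro i k hik
      have hpos : ∀ i k, t i k ≠ 0 → 0 < (t i k).re := fun i k h =>
        lt_of_le_of_ne (ht_nonneg i k) fun h0 => h (Complex.ext h0.symm (ht_real i k))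
      rcases ((SimpleGraph.fromRel_adj _ _ _).1 hik).2 with h | h
      · exact add_pos_of_pos_of_nonneg (hpos _ _ h) (ht_nonneg _ _)
      · exact add_pos_of_nonneg_of_pos (ht_nonneg _ _) (hpos _ _ h)
  · obtain ⟨EB, b, hb⟩ := exists_isGroundPair hBs
    obtain ⟨EF, f, hf⟩ := exists_isGroundPair hFs
    refine ⟨EB, EF, ?_, ?_, hdom.groundEnergy_le hb hf⟩
    · have := hB.isGroundStateEnergy occupation_injective hb
      rwa [range_occupation] at this
    · have := hF.isGroundStateEnergy Function.injective_id hf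
      rwa [Set.range_id, Finsupp.supported_univ] at this
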